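/- Let $\mathcal A$ be a finite alphabet, $\mathcal A^*$ the free monoid of finite words over $\mathcal A$, $\varphi:\mathcal A^*\to\mathcal A^*$ a monoid homomorphism (not assumed to be non-erasing or injective) and $w\in\mathcal A^*$ a non-empty word; the triple $G=(\mathcal A,\varphi,w)$ is called a D0L-system. Let $S(L(G))$ be the set of all factors (contiguous subwords) of the words $\varphi^n(w)$, $n\ge 0$. Call $G$ repetitive if for every integer $k\ge 1$ there is a non-empty word $v$ with $v^k\in S(L(G))$. For a non-empty word $v$, say that $v^\omega$ is an infinite periodic factor of $G$ if $v^k\in S(L(G))$ for all integers $k\ge 1$. A word $v$ is primitive if $v=z^k$ with $z\in\mathcal A^*$, $k\ge 0$ implies $k=1$. Then for every repetitive D0L-system $G$ there are only finitely many primitive words $v\in\mathcal A^*$ such that $v^\omega$ is an infinite periodic factor of $G$. -/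

import Mathlib

/-- A word `v` is a factor of a word `u` if `u = x v y` for some words `x`, `y`. -/
def IsWordFactor {A : Type*} (v u : FreeMonoid A) : Prop :=
  ∃ x y : FreeMonoid A, u = x * v * y

/-- A word `v` is primitive if `v = z ^ k` implies `k = 1`. (The empty word is not primitive.) -/
def IsPrimitiveWord {A : Type*} (v : FreeMonoid A) : Prop :=
  ∀ (z : FreeMonoid A) (k : ℕ), v = z ^ k → k = 1

/-- A D0L-system on the alphabet `A`: a morphism of the free monoid of words over `A`
(possibly erasing, possibly not injective) and a non-empty starting word. -/
structure D0LSystem (A : Type*) where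
  /-- the morphism `φ` -/
  morphism : FreeMonoid A →* FreeMonoid A
  /-- the axiom `w` -/
  start : FreeMonoid A
  start_ne_one : start ≠ 1

namespace D0LSystem

variable {A : Type*}

/-- The language `L(G) = {φ ^ k (w) | k ∈ ℕ}`. -/
def language (G : D0LSystem A) : Set (FreeMonoid A) :=
  {u | ∃ k : ℕ, u = (⇑G.morphism)^[k] G.start}

/-- The set `S(L(G))` of all factors of elements of the language. -/
def factors (G : D0LSystem A) : Set (FreeMonoid A) :=
  {v | ∃ u ∈ G.language, IsWordFactor v u}

/-- `G` is repetitive if for every positive `k` some non-empty word `v` has `v ^ k ∈ S(L(G))`. -/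
def IsRepetitive (G : D0LSystem A) : Prop :=
  ∀ k : ℕ, 0 < k → ∃ v : FreeMonoid A, v ≠ 1 ∧ v ^ k ∈ G.factors

/-- `v ^ ω` is an infinite periodic factor of `G`: the word `v` is non-empty and
`v ^ k ∈ S(L(G))` for all positive integers `k`. -/
def IsInfinitePeriodicFactor (G : D0LSystem A) (v : FreeMonoid A) : Prop :=
  v ≠ 1 ∧ ∀ k : ℕ, 0 < k → v ^ k ∈ G.factors

end D0LSystem

/-! Over a finite alphabet it is enough to bound the length of `v`. The main tool is Fine–Wilf
(`Primitive.length_dvd`): if `v` is primitive, a long common factor of powers of `v` and `u` forces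
`|v|` to divide `|u|`. Call a letter bounded if its iterated images stay bounded in length.

If `v` contains an unbounded letter, then for every `q` powers of `v` contain a whole block `φ^q(a)`
with `a` unbounded. More than `|A|` lengths would give two such words sharing `a`; for `q` large
their lengths divide each other (`finite_length_of_not_bounded`).

If all letters of `v` are bounded, descending through the iterates puts a long factor of a power of
`v` at an end of some `φ^n(x)` with `x` unbounded. The maximal bounded prefix of `φ^n(x)` is, up to
ends of bounded length, a power of one of finitely many words, so Fine–Wilf bounds `|v|`; suffixes
follow by reversal (`exists_length_le_of_bounded`). -/

namespace D0LWords

open List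

variable {A : Type*}

/-! ### Powers, periods and primitive words -/

/-- The power `v ^ k` of a word given as a list. -/
def wpow (v : List A) (k : ℕ) : List A := (List.replicate k v).flatten

@[simp] lemma wpow_zero (v : List A) : wpow v 0 = [] := rfl

lemma wpow_succ (v : List A) (k : ℕ) : wpow v (k + 1) = v ++ wpow v k := by
  simp [wpow, List.replicate_succ]

lemma wpow_succ' (v : List A) (k : ℕ) : wpow v (k + 1) = wpow v k ++ v := by
  simp [wpow, List.replicate_succ']

@[simp] lemma length_wpow (v : List A) (k : ℕ) : (wpow v k).length = k * v.length := by
  simp [wpow]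

lemma wpow_add (v : List A) (j k : ℕ) : wpow v (j + k) = wpow v j ++ wpow v k := by
  rw [wpow, wpow, wpow, List.replicate_add, List.flatten_append]

lemma reverse_wpow (v : List A) (k : ℕ) : (wpow v k).reverse = wpow v.reverse k := by
  simp [wpow, List.reverse_flatten]

lemma mem_of_mem_wpow {v : List A} {k : ℕ} {a : A} (h : a ∈ wpow v k) : a ∈ v := by
  simp only [wpow, List.mem_flatten, List.mem_replicate] at h
  obtain ⟨l, ⟨-, rfl⟩, hl⟩ := h
  exact hl

lemma hasPeriod_wpow (v : List A) (k : ℕ) : HasPeriod (wpow v k) v.length := by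
  cases k with
  | zero => exact hasPeriod_empty _
  | succ k =>
    have h : take v.length (wpow v (k + 1)) = v := by simp [wpow_succ]
    rw [HasPeriod, h, ← wpow_succ, wpow_succ' v (k + 1)]
    exact prefix_append _ _

lemma getElem?_wpow {v : List A} {k i : ℕ} (hi : i < k * v.length) :
    (wpow v k)[i]? = v[i % v.length]? := by
  have h := (hasPeriod_iff_forall_getElem?_mod.1 (hasPeriod_wpow v k)) i (by simpa using hi)
  rw [h]
  have hv : 0 < v.length := by
    rcases Nat.eq_zero_or_pos v.length with h0 | h0
    · simp [h0] at hi
    · exact h0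
  cases k with
  | zero => simp at hi
  | succ k => rw [wpow_succ, List.getElem?_append_left (Nat.mod_lt _ hv)]

/-- Primitivity of a word given as a list. -/
def Primitive (v : List A) : Prop := ∀ (z : List A) (k : ℕ), v = wpow z k → k = 1

lemma Primitive.length_pos {v : List A} (hv : Primitive v) : 0 < v.length := by
  rcases v with _ | ⟨a, v⟩
  · exact absurd (hv [] 0 rfl) (by simp)
  · simp

lemma Primitive.reverse {v : List A} (hv : Primitive v) : Primitive v.reverse := by
  intro z k h
  refine hv z.reverse k ?_
  rw [← reverse_wpow, ← h, List.reverse_reverse]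

lemma eq_wpow_of_hasPeriod {v : List A} {g n : ℕ} (hlen : v.length = n * g)
    (h : HasPeriod v g) : v = wpow (v.take g) n := by
  rcases Nat.eq_zero_or_pos n with rfl | hn
  · simp at hlen; simp [hlen]
  have hg : g ≤ v.length := by rw [hlen]; exact Nat.le_mul_of_pos_left g hn
  have hz : (v.take g).length = g := by simp [hg]
  apply List.ext_getElem?
  intro i
  by_cases hi : i < v.length
  · rw [getElem?_wpow (by rw [hz, ← hlen]; exact hi), hz,
      (hasPeriod_iff_forall_getElem?_mod.1 h) i hi]
    have hg0 : 0 < g := by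
      rcases Nat.eq_zero_or_pos g with rfl | h0
      · simp [hlen] at hi
      · exact h0
    rw [List.getElem?_take_of_lt (Nat.mod_lt _ hg0)]
  · rw [List.getElem?_eq_none (by omega), List.getElem?_eq_none]
    rw [length_wpow, hz]; omega

/-- The first `|v|` positions of `f` meet every residue mod `|v|`, so each comparison of `v[j]` with
`v[j + g]` can be made inside `f`. -/
lemma hasPeriod_of_infix_wpow {v f : List A} {k g : ℕ} (hf : f <:+: wpow v k)
    (hg : HasPeriod f g) (hlen : v.length + g ≤ f.length) : HasPeriod v g := by
  rw [hasPeriod_iff_getElem?] at hg ⊢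
  intro j hj
  obtain ⟨s, t, hst⟩ := hf
  have hv : 0 < v.length := by omega
  have hfk : s.length + f.length ≤ k * v.length := by
    rw [← length_wpow, ← hst]; simp
  have key : ∀ i, i < f.length → f[i]? = v[(s.length + i) % v.length]? := by
    intro i hi
    rw [← getElem?_wpow (k := k) (by omega), ← hst, List.append_assoc,
      List.getElem?_append_right (by omega), List.getElem?_append_left (by omega)]
    congr 1
    omega
  obtain ⟨i, hi, hmod⟩ : ∃ i, i < v.length ∧ (s.length + i) % v.length = j := by
    refine ⟨(j + (v.length - s.length % v.length)) % v.length, Nat.mod_lt _ hv, ?_⟩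
    have h1 : s.length % v.length < v.length := Nat.mod_lt _ hv
    rw [Nat.add_mod_mod]
    have h2 : s.length = s.length % v.length + v.length * (s.length / v.length) :=
      (Nat.mod_add_div _ _).symm
    have h3 : s.length + (j + (v.length - s.length % v.length))
        = j + v.length * (s.length / v.length + 1) := by
      rw [Nat.mul_add]; omega
    rw [h3, Nat.add_mul_mod_self_left, Nat.mod_eq_of_lt (by omega)]
  have h1 := key i (by omega)
  have h2 := key (i + g) (by omega)
  have h3 := hg i (by omega)
  rw [h1, h2, hmod, ← Nat.add_assoc, ← Nat.mod_add_mod, hmod,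
    Nat.mod_eq_of_lt (show j + g < v.length by omega)] at h3
  exact h3

/-- A long common factor of powers of `v` and `u`, with `v` primitive, forces `|v| ∣ |u|`. -/
lemma Primitive.length_dvd {v u f : List A} (hv : Primitive v) {k t : ℕ}
    (h1 : f <:+: wpow v k) (h2 : f <:+: wpow u t) (hlen : u.length + v.length ≤ f.length) :
    v.length ∣ u.length := by
  rcases Nat.eq_zero_or_pos u.length with hu | hu
  · simp [hu]
  have p1 := (hasPeriod_wpow v k).infix h1
  have p2 := (hasPeriod_wpow u t).infix h2
  -- Fine–Wilf gives `f` the gcd as a period. It passes to `v`, whose primitivity then forces the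
  -- gcd to be `|v|`.
  have p3 := p1.gcd p2 (by omega)
  have hg := Nat.gcd_dvd_left v.length u.length
  have hgu := Nat.gcd_dvd_right v.length u.length
  have p4 := hasPeriod_of_infix_wpow h1 p3 (by have := Nat.le_of_dvd hu hgu; omega)
  have hq : v.length = (v.length / v.length.gcd u.length) * v.length.gcd u.length :=
    (Nat.div_mul_cancel hg).symm
  have h5 := hv _ _ (eq_wpow_of_hasPeriod hq p4)
  rw [h5, one_mul] at hq
  rwa [← hq] at hgu

/-- A factor of `x y z` has a factor in `y` that is shorter by at most `|x| + |z|`. -/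
lemma exists_infix_mid {f x y z : List A} (h : f <:+: x ++ y ++ z) :
    ∃ g, g <:+: f ∧ g <:+: y ∧ f.length ≤ g.length + x.length + z.length := by
  have key : ∀ {f x y : List A}, f <:+: x ++ y →
      ∃ g, g <:+: f ∧ g <:+: y ∧ f.length ≤ g.length + x.length := by
    intro f x y h
    rcases List.infix_append_iff.1 h with h | h | ⟨a, b, rfl, ha, hb⟩
    · exact ⟨[], List.nil_infix, List.nil_infix, by simpa using h.length_le⟩
    · exact ⟨f, List.infix_rfl, h, by omega⟩
    · refine ⟨b, (List.suffix_append _ _).isInfix, hb.isInfix, ?_⟩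
      have := ha.length_le
      simp; omega
  have key' : ∀ {f x y : List A}, f <:+: x ++ y →
      ∃ g, g <:+: f ∧ g <:+: x ∧ f.length ≤ g.length + y.length := by
    intro f x y h
    rcases List.infix_append_iff.1 h with h | h | ⟨a, b, rfl, ha, hb⟩
    · exact ⟨f, List.infix_rfl, h, by omega⟩
    · exact ⟨[], List.nil_infix, List.nil_infix, by simpa using h.length_le⟩
    · refine ⟨a, (List.prefix_append _ _).isInfix, ha.isInfix, ?_⟩
      have := hb.length_le
      simp; omega
  obtain ⟨g, g1, g2, g3⟩ := key' h
  obtain ⟨e, e1, e2, e3⟩ := key g2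
  exact ⟨e, e1.trans g1, e2, by omega⟩

/-! ### Iterated images and bounded letters -/

/-- The `n`-th iterate, applied to `w`, of the morphism given by the images of the letters. -/
def img (f : A → List A) (n : ℕ) (w : List A) : List A := (fun u : List A => u.flatMap f)^[n] w

@[simp] lemma img_zero (f : A → List A) (w : List A) : img f 0 w = w := rfl

lemma img_add (f : A → List A) (m n : ℕ) (w : List A) : img f (m + n) w = img f m (img f n w) :=
  Function.iterate_add_apply _ _ _ _

lemma img_one (f : A → List A) (w : List A) : img f 1 w = w.flatMap f := rfl

lemma img_one_singleton (f : A → List A) (a : A) : img f 1 [a] = f a := by simp [img_one]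

lemma img_succ (f : A → List A) (n : ℕ) (w : List A) : img f (n + 1) w = img f n (img f 1 w) :=
  img_add f n 1 w

lemma img_succ' (f : A → List A) (n : ℕ) (w : List A) : img f (n + 1) w = img f 1 (img f n w) := by
  rw [Nat.add_comm, img_add]

@[simp] lemma img_append (f : A → List A) (n : ℕ) (u w : List A) :
    img f n (u ++ w) = img f n u ++ img f n w := by
  induction n with
  | zero => rfl
  | succ n ih => rw [img_succ', ih, img_succ' f n u, img_succ' f n w]; simp [img_one]

@[simp] lemma img_nil (f : A → List A) (n : ℕ) : img f n [] = [] := by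
  induction n with
  | zero => rfl
  | succ n ih => rw [img_succ', ih]; rfl

lemma img_cons (f : A → List A) (n : ℕ) (a : A) (w : List A) :
    img f n (a :: w) = img f n [a] ++ img f n w := by
  rw [← img_append]; rfl

lemma mem_img {f : A → List A} {n : ℕ} {w : List A} {x : A} :
    x ∈ img f n w ↔ ∃ a ∈ w, x ∈ img f n [a] := by
  induction w with
  | nil => simp
  | cons a w ih => rw [img_cons, List.mem_append, ih]; simp

lemma length_img_le_of_mem {f : A → List A} {n : ℕ} {w : List A} {a : A} (h : a ∈ w) :
    (img f n [a]).length ≤ (img f n w).length := by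
  obtain ⟨s, t, rfl⟩ := List.append_of_mem h
  rw [img_append, img_cons f n a t]
  simp; omega

lemma length_img_le {f : A → List A} {n K : ℕ} {w : List A}
    (h : ∀ a ∈ w, (img f n [a]).length ≤ K) : (img f n w).length ≤ w.length * K := by
  induction w with
  | nil => simp
  | cons a w ih =>
    rw [img_cons, List.length_append, List.length_cons, Nat.add_mul, one_mul, Nat.add_comm]
    exact Nat.add_le_add (ih fun b hb => h b (by simp [hb])) (h a (by simp))

lemma img_reverse (f : A → List A) (n : ℕ) (w : List A) :
    (img f n w).reverse = img (fun a => (f a).reverse) n w.reverse := by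
  induction n generalizing w with
  | zero => rfl
  | succ n ih =>
    rw [img_succ, ih, img_succ]
    refine congrArg (img _ n) ?_
    simp [img_one, List.reverse_flatMap, Function.comp_def]

/-- A letter is bounded if its iterated images have bounded length. -/
def Bounded (f : A → List A) (a : A) : Prop := ∃ K, ∀ n, (img f n [a]).length ≤ K

lemma bounded_reverse_iff {f : A → List A} {a : A} :
    Bounded (fun a => (f a).reverse) a ↔ Bounded f a := by
  have h : ∀ n, (img (fun a => (f a).reverse) n [a]).length = (img f n [a]).length := by
    intro n
    rw [← List.length_reverse (as := img f n [a]), img_reverse]; rfl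
  simp only [Bounded, h]

lemma Bounded.of_mem_img {f : A → List A} {a x : A} {n : ℕ} (ha : Bounded f a)
    (hx : x ∈ img f n [a]) : Bounded f x := by
  obtain ⟨K, hK⟩ := ha
  refine ⟨K, fun m => ?_⟩
  refine (length_img_le_of_mem hx).trans ?_
  rw [← img_add]
  exact hK _

lemma forall_bounded_img {f : A → List A} {w : List A} (h : ∀ a ∈ w, Bounded f a) (n : ℕ) :
    ∀ a ∈ img f n w, Bounded f a := by
  intro x hx
  obtain ⟨a, ha, hxa⟩ := mem_img.1 hx
  exact (h a ha).of_mem_img hxa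

lemma exists_length_img_le [Finite A] (f : A → List A) :
    ∃ K, ∀ a, Bounded f a → ∀ n, (img f n [a]).length ≤ K := by
  have h : ∀ a, ∃ K, Bounded f a → ∀ n, (img f n [a]).length ≤ K := by
    intro a
    by_cases ha : Bounded f a
    · exact ha.imp fun K hK _ => hK
    · exact ⟨0, fun h => absurd h ha⟩
  choose K hK using h
  obtain ⟨M, hM⟩ := (Set.finite_range K).bddAbove
  exact ⟨M, fun a ha n => (hK a ha n).trans (hM ⟨a, rfl⟩)⟩

lemma bounded_of_forall_mem_img [Finite A] {f : A → List A} {a : A} {n : ℕ}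
    (h : ∀ x ∈ img f n [a], Bounded f x) : Bounded f a := by
  obtain ⟨K, hK⟩ := exists_length_img_le f
  obtain ⟨M, hM⟩ := ((Set.finite_Iio n).image fun i => (img f i [a]).length).bddAbove
  refine ⟨M + (img f n [a]).length * K, fun i => ?_⟩
  rcases lt_or_ge i n with hi | hi
  · exact (hM ⟨i, hi, rfl⟩).trans (Nat.le_add_right _ _)
  · obtain ⟨j, rfl⟩ := Nat.exists_eq_add_of_le' hi
    rw [img_add]
    exact (length_img_le fun x hx => hK x (h x hx) j).trans (Nat.le_add_left _ _)

lemma exists_mem_img_not_bounded [Finite A] {f : A → List A} {a : A} (ha : ¬ Bounded f a)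
    (n : ℕ) : ∃ x ∈ img f n [a], ¬ Bounded f x := by
  by_contra! h
  exact ha (bounded_of_forall_mem_img h)

lemma bounded_of_img_eq [Finite A] {f : A → List A} {a : A} {i j : ℕ} (hij : i < j)
    (h : img f i [a] = img f j [a]) : Bounded f a := by
  obtain ⟨M, hM⟩ := ((Set.finite_Iio j).image fun i => (img f i [a]).length).bddAbove
  refine ⟨M, fun n => ?_⟩
  induction n using Nat.strong_induction_on with
  | _ n ih =>
    rcases lt_or_ge n j with hn | hn
    · exact hM ⟨n, hn, rfl⟩
    · obtain ⟨d, rfl⟩ := Nat.exists_eq_add_of_le' hn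
      rw [img_add, ← h, ← img_add]
      exact ih _ (by omega)

/-- The iterates of an unbounded letter never repeat, and there are only finitely many words of
length at most `K`. -/
lemma eventually_le_length_img [Finite A] {f : A → List A} {a : A} (ha : ¬ Bounded f a) (K : ℕ) :
    ∀ᶠ n in Filter.atTop, K ≤ (img f n [a]).length := by
  rw [← Nat.cofinite_eq_atTop, Filter.eventually_cofinite]
  have hinj : Function.Injective fun n => img f n [a] := by
    intro i j hij
    rcases lt_trichotomy i j with h | h | h
    · exact absurd (bounded_of_img_eq h hij) ha
    · exact h
    · exact absurd (bounded_of_img_eq h hij.symm) ha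
  refine ((List.finite_length_le A K).preimage hinj.injOn).subset ?_
  intro n hn
  simp only [Set.mem_ofPred_eq, not_le] at hn
  simp only [Set.mem_preimage, Set.mem_ofPred_eq]
  omega

/-! ### Eventually periodic orbits -/

/-- An orbit with finite range is eventually periodic, with the same number as preperiod and
period. -/
lemma exists_iterate_add_eq {X : Type*} (g : X → X) (x : X)
    (h : (Set.range fun n => g^[n] x).Finite) :
    ∃ m, 0 < m ∧ ∀ k, m ≤ k → g^[k + m] x = g^[k] x := by
  obtain ⟨i, j, hij, hx⟩ : ∃ i j, i < j ∧ g^[i] x = g^[j] x := by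
    have : ¬ Function.Injective fun n => g^[n] x := fun hinj => Set.infinite_range_of_injective hinj h
    simp only [Function.Injective, not_forall] at this
    obtain ⟨i, j, h1, h2⟩ := this
    rcases lt_or_gt_of_ne h2 with h | h
    · exact ⟨i, j, h, h1⟩
    · exact ⟨j, i, h, h1.symm⟩
  obtain ⟨p, rfl⟩ := Nat.exists_eq_add_of_lt hij
  have hstep : ∀ k, i ≤ k → g^[k + (p + 1)] x = g^[k] x := by
    intro k hk
    obtain ⟨d, rfl⟩ := Nat.exists_eq_add_of_le' hk
    rw [Nat.add_assoc, Function.iterate_add_apply, ← Nat.add_assoc, ← hx,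
      ← Function.iterate_add_apply]
  have hmul : ∀ q k, i ≤ k → g^[k + q * (p + 1)] x = g^[k] x := by
    intro q
    induction q with
    | zero => simp
    | succ q ih =>
      intro k hk
      rw [Nat.add_mul, one_mul, ← Nat.add_assoc, hstep _ (by omega), ih k hk]
  -- A multiple of the period `p + 1` that exceeds the preperiod `i`.
  refine ⟨(i + 1) * (p + 1), by positivity, fun k hk => hmul _ _ ?_⟩
  nlinarith

lemma iterate_add_mul_eq {X : Type*} {g : X → X} {x : X} {m : ℕ}
    (h : ∀ k, m ≤ k → g^[k + m] x = g^[k] x) (q k : ℕ) (hk : m ≤ k) :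
    g^[k + q * m] x = g^[k] x := by
  induction q with
  | zero => simp
  | succ q ih => rw [Nat.add_mul, one_mul, ← Nat.add_assoc, h _ (by omega), ih]

/-- Finitely many orbits with finite range have a common preperiod and period. -/
lemma exists_iterate_add_eq_forall {X ι : Type*} [Finite ι] (g : X → X) (x : ι → X)
    (h : ∀ a, (Set.range fun n => g^[n] (x a)).Finite) :
    ∃ m, 0 < m ∧ ∀ q a k, q * m ≤ k → 0 < q → g^[k + q * m] (x a) = g^[k] (x a) := by
  choose m hm0 hm using fun a => exists_iterate_add_eq g (x a) (h a)
  have := Fintype.ofFinite ι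
  refine ⟨∏ a, m a, Finset.prod_pos fun a _ => hm0 a, fun q a k hk hq => ?_⟩
  obtain ⟨c, hc⟩ := Finset.dvd_prod_of_mem m (Finset.mem_univ a)
  have e : q * ∏ a, m a = (q * c) * m a := by rw [hc]; ring
  have hpos : 0 < ∏ a, m a := Finset.prod_pos fun a _ => hm0 a
  rw [e]
  refine iterate_add_mul_eq (hm a) _ _ (le_trans ?_ hk)
  rw [hc] at hpos ⊢
  have hc0 : 0 < c := Nat.pos_of_mul_pos_left hpos
  rw [Nat.mul_comm (m a), ← Nat.mul_assoc]
  exact Nat.le_mul_of_pos_left _ (by positivity)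

/-! ### Bounded prefixes and suffixes of images of unbounded letters -/

lemma exists_eq_append_cons_of_mem {p : A → Prop} {w : List A} (h : ∃ x ∈ w, ¬ p x) :
    ∃ u r y, w = u ++ r :: y ∧ (∀ x ∈ u, p x) ∧ ¬ p r := by
  induction w with
  | nil => simp at h
  | cons a w ih =>
    by_cases ha : p a
    · obtain ⟨x, hx, hpx⟩ := h
      have hxw : x ∈ w := by
        rcases List.mem_cons.1 hx with rfl | hx
        · exact absurd ha hpx
        · exact hx
      obtain ⟨u, r, y, rfl, hu, hr⟩ := ih ⟨x, hxw, hpx⟩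
      refine ⟨a :: u, r, y, rfl, ?_, hr⟩
      intro z hz
      rcases List.mem_cons.1 hz with rfl | hz
      · exact ha
      · exact hu z hz
    · exact ⟨[], a, w, rfl, by simp, ha⟩

lemma prefix_of_prefix_append_cons {p : A → Prop} {t u y : List A} {r : A}
    (h : t <+: u ++ r :: y) (ht : ∀ x ∈ t, p x) (hr : ¬ p r) : t <+: u := by
  rcases le_or_gt t.length u.length with hl | hl
  · exact List.prefix_of_prefix_length_le h (List.prefix_append _ _) hl
  · have h2 : u ++ [r] <+: t :=
      List.prefix_of_prefix_length_le ⟨y, by simp⟩ h (by simpa using hl)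
    exact absurd (ht r (h2.subset (by simp))) hr

/-- The longest prefix of bounded letters of the `n`-th image of an unbounded letter `c`, computed
from the prefixes `p c` of bounded letters of `f c` and the letters `r c` that follow them. -/
def lead (f : A → List A) (p : A → List A) (r : A → A) : ℕ → A → List A
  | 0, _ => []
  | n + 1, c => img f 1 (lead f p r n c) ++ p (r^[n] c)

lemma lead_add (f : A → List A) (p : A → List A) (r : A → A) (k j : ℕ) (c : A) :
    lead f p r (k + j) c = img f j (lead f p r k c) ++ lead f p r j (r^[k] c) := by
  induction j with
  | zero => simp [lead]
  | succ j ih =>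
    rw [← Nat.add_assoc, lead, ih, lead, img_append, ← img_succ', List.append_assoc,
      ← Function.iterate_add_apply, Nat.add_comm k j]

/-- Images of bounded letters contain only bounded letters, so the first unbounded letter of the
next image comes from the image of `r^[n] c`. -/
lemma img_eq_lead {f : A → List A} {p y : A → List A} {r : A → A}
    (hp : ∀ c, ¬ Bounded f c → f c = p c ++ r c :: y c ∧ (∀ x ∈ p c, Bounded f x) ∧
      ¬ Bounded f (r c)) {c : A} (hc : ¬ Bounded f c) (n : ℕ) :
    ¬ Bounded f (r^[n] c) ∧ (∀ x ∈ lead f p r n c, Bounded f x) ∧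
      ∃ z, img f n [c] = lead f p r n c ++ r^[n] c :: z := by
  induction n with
  | zero => exact ⟨hc, by simp [lead], [], rfl⟩
  | succ n ih =>
    obtain ⟨h1, h2, z, hz⟩ := ih
    obtain ⟨e1, e2, e3⟩ := hp _ h1
    rw [Function.iterate_succ_apply']
    refine ⟨e3, ?_, y (r^[n] c) ++ img f 1 z, ?_⟩
    · intro x hx
      rcases List.mem_append.1 hx with hx | hx
      · exact forall_bounded_img h2 1 x hx
      · exact e2 x hx
    · rw [img_succ', hz, img_append, img_cons, img_one_singleton, e1, lead]
      simp

/-- After one application of `φ^m`, bounded words are fixed by further ones. Each return of `r` to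
`r^[k] c` therefore only appends the same block on the right. -/
lemma lead_periodic {f : A → List A} {p : A → List A} {r : A → A} {m k : ℕ} {c : A}
    (hk : ∀ x ∈ lead f p r k c, Bounded f x)
    (ha : ∀ x ∈ lead f p r m (r^[k] c), Bounded f x)
    (him : ∀ w : List A, (∀ x ∈ w, Bounded f x) → img f (m + m) w = img f m w)
    (hr : r^[m] (r^[k] c) = r^[k] c) (t : ℕ) :
    img f m (lead f p r (k + t * m) c) =
      img f m (lead f p r k c) ++ wpow (img f m (lead f p r m (r^[k] c))) t := by
  induction t with
  | zero => simp
  | succ t ih =>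
    have e : r^[k + t * m] c = r^[k] c := by
      clear ih
      induction t with
      | zero => simp
      | succ t ih =>
        rw [Nat.add_mul, one_mul, ← Nat.add_assoc, Nat.add_comm, Function.iterate_add_apply, ih, hr]
    have hall : ∀ x ∈ img f m (lead f p r (k + t * m) c), Bounded f x := by
      rw [ih]
      intro x hx
      rcases List.mem_append.1 hx with hx | hx
      · exact forall_bounded_img hk m x hx
      · exact forall_bounded_img ha m x (mem_of_mem_wpow hx)
    have e2 : img f m (img f m (lead f p r (k + t * m) c)) = img f m (lead f p r (k + t * m) c) := by
      rw [ih, img_append, ← img_add, him _ hk]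
      congr 1
      clear ih hall e
      induction t with
      | zero => simp
      | succ t ih => rw [wpow_succ, img_append, ih, ← img_add, him _ ha]
    rw [Nat.add_mul, one_mul, ← Nat.add_assoc, lead_add, e, img_append, e2, ih, wpow_succ',
      List.append_assoc]

lemma exists_common_period [Finite A] (f : A → List A) (r : A → A) :
    ∃ m, 0 < m ∧ (∀ w : List A, (∀ x ∈ w, Bounded f x) → img f (m + m) w = img f m w) ∧
      ∀ k c, m ≤ k → r^[k + m] c = r^[k] c := by
  obtain ⟨m₁, h1, H1⟩ := exists_iterate_add_eq_forall (ι := {a // Bounded f a})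
    (fun u : List A => u.flatMap f) (fun a => [a.1]) (by
      rintro ⟨a, K, hK⟩
      refine (List.finite_length_le A K).subset ?_
      rintro _ ⟨n, rfl⟩
      exact hK n)
  obtain ⟨m₂, h2, H2⟩ := exists_iterate_add_eq_forall r (fun a : A => a)
    (fun a => Set.toFinite _)
  refine ⟨m₁ * m₂, Nat.mul_pos h1 h2, fun w hw => ?_, fun k c hk => H2 m₁ c k hk h1⟩
  induction w with
  | nil => simp
  | cons a w ih =>
    rw [img_cons, img_cons f (m₁ * m₂), ih fun x hx => hw x (by simp [hx])]
    congr 1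
    have := H1 m₂ ⟨a, hw a (by simp)⟩ (m₁ * m₂) (by rw [Nat.mul_comm]) h2
    rwa [Nat.mul_comm m₂ m₁] at this

/-- If a power of a primitive word `v` has a very long factor that is a prefix of bounded letters
of an iterated image of an unbounded letter, then `v` is short. -/
lemma exists_length_le_of_prefix [Finite A] (f : A → List A) :
    ∃ D, ∀ (n : ℕ) (c : A) (t v : List A) (k : ℕ), ¬ Bounded f c → t <+: img f n [c] →
      (∀ x ∈ t, Bounded f x) → Primitive v → t <:+: wpow v k → D + v.length ≤ t.length →
      v.length ≤ D := by
  have hex : ∀ c, ∃ u r y, ¬ Bounded f c → f c = u ++ r :: y ∧ (∀ x ∈ u, Bounded f x) ∧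
      ¬ Bounded f r := by
    intro c
    by_cases hc : Bounded f c
    · exact ⟨[], c, [], fun h => absurd hc h⟩
    · obtain ⟨u, r, y, h⟩ := exists_eq_append_cons_of_mem (exists_mem_img_not_bounded hc 1)
      rw [img_one_singleton] at h
      exact ⟨u, r, y, fun _ => h⟩
  choose p r y hp using hex
  obtain ⟨m, hm, him, hrm⟩ := exists_common_period f r
  obtain ⟨D, hD⟩ : ∃ D, ∀ c k, k < 2 * m → (lead f p r k c).length ≤ D ∧
      (img f m (lead f p r k c)).length ≤ D := by
    obtain ⟨D, hD⟩ := (((Set.finite_univ (α := A)).prod (Set.finite_Iio (2 * m))).image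
      fun x => (lead f p r x.2 x.1).length + (img f m (lead f p r x.2 x.1)).length).bddAbove
    refine ⟨D, fun c k hk => ?_⟩
    have := hD ⟨(c, k), ⟨trivial, hk⟩, rfl⟩
    simp only at this
    omega
  -- One `D` for each end cut off around the periodic part, and one for the length of the repeating
  -- block.
  refine ⟨3 * D, fun n c t v i hc ht htb hv htv hlen => ?_⟩
  obtain ⟨hrn, -, z, hz⟩ := img_eq_lead hp hc n
  rw [hz] at ht
  have ht' := prefix_of_prefix_append_cons ht htb hrn
  rcases lt_or_ge n (2 * m) with hn | hn
  · have h1 := (hD c n hn).1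
    have h2 := ht'.length_le
    omega
  · obtain ⟨k, q, hkm, hk2, rfl⟩ : ∃ k q, m ≤ k ∧ k < 2 * m ∧ n = k + q * m + m := by
      have h1 := Nat.mod_add_div (n - 2 * m) m
      have h2 := Nat.mod_lt (n - 2 * m) hm
      refine ⟨m + (n - 2 * m) % m, (n - 2 * m) / m, by omega, by omega, ?_⟩
      rw [Nat.mul_comm ((n - 2 * m) / m)]
      omega
    have hr : r^[m] (r^[k] c) = r^[k] c := by
      rw [← Function.iterate_add_apply, Nat.add_comm, hrm k c hkm]
    have hq : r^[k + q * m] c = r^[k] c := iterate_add_mul_eq (fun k hk => hrm k c hk) q k hkm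
    obtain ⟨hrk, hkb, -⟩ := img_eq_lead hp hc k
    obtain ⟨-, hab, -⟩ := img_eq_lead hp hrk m
    rw [lead_add, lead_periodic hkb hab him hr q, hq] at ht'
    obtain ⟨g, g1, g2, g3⟩ := exists_infix_mid ht'.isInfix
    have b1 := (hD c k hk2).2
    have b2 := hD (r^[k] c) m (by omega)
    have hdvd := hv.length_dvd (g1.trans htv) g2 (by omega)
    have hg := g2.length_le
    have hv0 := hv.length_pos
    -- An empty block would make `g` empty, although `|g| ≥ |v| > 0`.
    rcases Nat.eq_zero_or_pos (img f m (lead f p r m (r^[k] c))).length with h0 | h0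
    · rw [length_wpow, h0] at hg
      omega
    · have := Nat.le_of_dvd h0 hdvd
      omega

lemma exists_length_le_of_suffix [Finite A] (f : A → List A) :
    ∃ D, ∀ (n : ℕ) (c : A) (t v : List A) (k : ℕ), ¬ Bounded f c → t <:+ img f n [c] →
      (∀ x ∈ t, Bounded f x) → Primitive v → t <:+: wpow v k → D + v.length ≤ t.length →
      v.length ≤ D := by
  obtain ⟨D, hD⟩ := exists_length_le_of_prefix fun a => (f a).reverse
  refine ⟨D, fun n c t v k hc ht htb hv htv hlen => ?_⟩
  have := hD n c t.reverse v.reverse k (by rwa [bounded_reverse_iff])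
    (by
      have h := List.reverse_prefix.2 ht
      rwa [img_reverse] at h)
    (by simpa [bounded_reverse_iff] using htb) hv.reverse
    (by rw [← reverse_wpow]; exact List.reverse_infix.2 htv) (by simpa using hlen)
  simpa using this

/-! ### Words of bounded letters -/

lemma exists_of_prefix_img {f : A → List A} {n : ℕ} {w t : List A} (h : t <+: img f n w) :
    ∃ g p, t = img f n g ++ p ∧ g <+: w ∧ (p = [] ∨ ∃ x ∈ w, p <+: img f n [x]) := by
  induction w generalizing t with
  | nil => exact ⟨[], [], by simpa using h, List.prefix_rfl, Or.inl rfl⟩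
  | cons a w ih =>
    obtain ⟨y, hy⟩ := h
    rw [img_cons, List.append_eq_append_iff] at hy
    rcases hy with ⟨b, hb, -⟩ | ⟨b, rfl, hb⟩
    · exact ⟨[], t, by simp, List.nil_prefix, Or.inr ⟨a, by simp, b, hb.symm⟩⟩
    · obtain ⟨g, p, rfl, hg, hp⟩ := ih ⟨y, hb.symm⟩
      refine ⟨a :: g, p, ?_, by simpa using hg, ?_⟩
      · rw [img_cons f n a g, List.append_assoc]
      · exact hp.imp_right fun ⟨x, hx, h⟩ => ⟨x, by simp [hx], h⟩

lemma exists_of_infix_img {f : A → List A} {n : ℕ} {w t : List A} (h : t <:+: img f n w) :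
    t = [] ∨ (∃ x ∈ w, t <:+: img f n [x]) ∨ ∃ s g p, t = s ++ img f n g ++ p ∧
      g.length ≤ w.length ∧ (∃ x ∈ w, s <:+ img f n [x]) ∧
      (p = [] ∨ ∃ x ∈ w, p <+: img f n [x]) := by
  induction w with
  | nil => exact Or.inl (by simpa using h)
  | cons a w ih =>
    rw [img_cons, List.infix_append_iff] at h
    rcases h with h | h | ⟨s, t', rfl, hs, ht'⟩
    · exact Or.inr (Or.inl ⟨a, by simp, h⟩)
    · rcases ih h with h | ⟨x, hx, h⟩ | ⟨s, g, p, rfl, hg, ⟨x, hx, hs⟩, hp⟩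
      · exact Or.inl h
      · exact Or.inr (Or.inl ⟨x, by simp [hx], h⟩)
      · refine Or.inr (Or.inr ⟨s, g, p, rfl, hg.trans (by simp), ⟨x, by simp [hx], hs⟩, ?_⟩)
        exact hp.imp_right fun ⟨x, hx, h⟩ => ⟨x, by simp [hx], h⟩
    · obtain ⟨g, p, rfl, hg, hp⟩ := exists_of_prefix_img ht'
      refine Or.inr (Or.inr ⟨s, g, p, by simp, hg.length_le.trans (by simp), ⟨a, by simp, hs⟩, ?_⟩)
      exact hp.imp_right fun ⟨x, hx, h⟩ => ⟨x, by simp [hx], h⟩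

lemma exists_length_apply_le [Finite A] (g : A → List A) : ∃ M, ∀ a, (g a).length ≤ M := by
  obtain ⟨M, hM⟩ := (Set.finite_range fun a => (g a).length).bddAbove
  exact ⟨M, fun a => hM ⟨a, rfl⟩⟩

/-- Primitive words of bounded letters all of whose powers are factors of the iterates of `w` have
bounded length. -/
lemma exists_length_le_of_bounded [Finite A] (f : A → List A) (w : List A) :
    ∃ D, ∀ v : List A, Primitive v → (∀ x ∈ v, Bounded f x) →
      (∀ N, ∃ n, wpow v N <:+: img f n w) → v.length ≤ D := by
  obtain ⟨D₁, hD₁⟩ := exists_length_le_of_prefix f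
  obtain ⟨D₂, hD₂⟩ := exists_length_le_of_suffix f
  obtain ⟨K, hK⟩ := exists_length_img_le f
  obtain ⟨M, hM⟩ := exists_length_apply_le f
  refine ⟨max D₁ D₂, fun v hv hb hpow => ?_⟩
  set C := max M w.length
  set E := D₁ + D₂ + K + v.length + 1 with hE
  -- `C` bounds both `w` and the images of letters, so the induction may replace `W` by `f x`.
  -- Complete blocks contribute at most `C * K`; hence one end has length at least `E`, which
  -- exceeds `K` and so comes from an unbounded letter.
  have main : ∀ n W t k, W.length ≤ C → t <:+: wpow v k → 2 * E + C * K ≤ t.length →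
      t <:+: img f n W → v.length ≤ max D₁ D₂ := by
    intro n
    induction n using Nat.strong_induction_on with
    | _ n ih =>
      intro W t k hW htv htl ht
      have htb : ∀ x ∈ t, Bounded f x := fun x hx => hb x (mem_of_mem_wpow (htv.subset hx))
      rcases exists_of_infix_img ht with rfl | ⟨x, hx, h⟩ | ⟨s, g, p, rfl, hg, ⟨x, hx, hs⟩, hp⟩
      · simp at htl
      · cases n with
        | zero =>
          have := h.length_le
          simp at this
          omega
        | succ n =>
          rw [img_succ, img_one_singleton] at h
          exact ih n (Nat.lt_succ_self n) _ t k ((hM x).trans (le_max_left _ _)) htv htl h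
      · have hgb : ∀ a ∈ g, Bounded f a := fun a ha => bounded_of_forall_mem_img fun y hy =>
          htb y (by simp only [List.mem_append]; exact Or.inl (Or.inr (mem_img.2 ⟨a, ha, hy⟩)))
        have hgl := length_img_le fun a ha => hK a (hgb a ha) n
        have hgC : g.length * K ≤ C * K := Nat.mul_le_mul_right K (hg.trans hW)
        simp only [List.length_append] at htl
        rcases le_or_gt E s.length with hsl | hsl
        · have hxb : ¬ Bounded f x := fun hxb => by
            have h1 := hK x hxb n
            have h2 := hs.length_le
            omega
          refine (hD₂ n x s v k hxb hs (fun y hy => htb y (by simp [hy])) hv ?_ (by omega)).trans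
            (le_max_right _ _)
          exact List.IsInfix.trans ⟨[], img f n g ++ p, by simp⟩ htv
        · have hpl : E ≤ p.length := by omega
          rcases hp with rfl | ⟨x, hx, hp⟩
          · simp at hpl
          · have hxb : ¬ Bounded f x := fun hxb => by
              have h1 := hK x hxb n
              have h2 := hp.length_le
              omega
            refine (hD₁ n x p v k hxb hp (fun y hy => htb y (by simp [hy])) hv ?_ (by omega)).trans
              (le_max_left _ _)
            exact List.IsInfix.trans ⟨s ++ img f n g, [], by simp⟩ htv
  obtain ⟨n, hn⟩ := hpow (2 * E + C * K)
  refine main n w _ _ (le_max_right _ _) List.infix_rfl ?_ hn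
  rw [length_wpow]
  exact Nat.le_mul_of_pos_right _ hv.length_pos

/-! ### Words with an unbounded letter -/

lemma exists_img_singleton_eq {f : A → List A} {n : ℕ} {w x y : List A} {c : A}
    (h : img f n w = x ++ c :: y) :
    ∃ a ∈ w, ∃ s t, img f n [a] = s ++ c :: t ∧ s <:+ x ∧ t <+: y := by
  induction w generalizing x with
  | nil => simp at h
  | cons a w ih =>
    rw [img_cons, List.append_eq_append_iff] at h
    rcases h with ⟨b, rfl, hb⟩ | ⟨b, hb, hb'⟩
    · obtain ⟨a', ha', s, t, h1, h2, h3⟩ := ih hb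
      exact ⟨a', by simp [ha'], s, t, h1, h2.trans (List.suffix_append _ _), h3⟩
    · cases b with
      | nil =>
        obtain ⟨a', ha', s, t, h1, h2, h3⟩ := ih (x := []) hb'.symm
        exact ⟨a', by simp [ha'], s, t, h1, h2.trans (List.nil_suffix), h3⟩
      | cons d b =>
        simp only [List.cons_append, List.cons.injEq] at hb'
        obtain ⟨rfl, rfl⟩ := hb'
        exact ⟨a, by simp, x, b, hb, List.suffix_rfl, List.prefix_append _ _⟩

/-- The block `φ^q(a)` around an occurrence of `c` deep inside a high power is too short to leave
that power, and `a` is unbounded because `c` is. -/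
lemma exists_img_infix_wpow [Finite A] {f : A → List A} {w v : List A}
    (hv : ∃ c ∈ v, ¬ Bounded f c) (hpow : ∀ N, ∃ n, wpow v N <:+: img f n w) (q : ℕ) :
    ∃ a k, ¬ Bounded f a ∧ img f q [a] <:+: wpow v k := by
  obtain ⟨c, hcv, hc⟩ := hv
  obtain ⟨v₁, v₂, rfl⟩ := List.append_of_mem hcv
  set v := v₁ ++ c :: v₂ with hvdef
  have hv0 : 0 < v.length := List.length_pos_of_mem hcv
  obtain ⟨M, hM⟩ := exists_length_apply_le fun a => img f q [a]
  obtain ⟨E, hE⟩ := ((Set.finite_Iio q).image fun i => (img f i w).length).bddAbove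
  -- `M` copies of `v` on each side contain the block; `E` more make the power too long for the
  -- iterates below `q`.
  obtain ⟨n, hn⟩ := hpow (M + 1 + (M + E))
  have hlen : M + 1 + (M + E) ≤ (wpow v (M + 1 + (M + E))).length := by
    rw [length_wpow]; exact Nat.le_mul_of_pos_right _ hv0
  have hqn : q ≤ n := by
    by_contra! hlt
    have h1 : (img f n w).length ≤ E := hE ⟨n, hlt, rfl⟩
    have h2 := hn.length_le
    omega
  obtain ⟨j, rfl⟩ := Nat.exists_eq_add_of_le hqn
  have hsplit : wpow v (M + 1 + (M + E)) =
      (wpow v M ++ v₁) ++ c :: (v₂ ++ wpow v (M + E)) := by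
    rw [wpow_add, wpow_succ']
    simp [hvdef]
  obtain ⟨x, y, hxy⟩ := hn
  rw [img_add, hsplit] at hxy
  obtain ⟨a, -, s, t, hst, hs, ht⟩ := exists_img_singleton_eq
    (x := x ++ (wpow v M ++ v₁)) (c := c) (y := (v₂ ++ wpow v (M + E)) ++ y)
    (by rw [← hxy]; simp)
  have hl := hM a
  simp only [hst, List.length_append, List.length_cons] at hl
  have hMv : M ≤ M * v.length := Nat.le_mul_of_pos_right _ hv0
  have hs' : s <:+ wpow v M ++ v₁ := by
    refine List.suffix_of_suffix_length_le hs (List.suffix_append _ _) ?_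
    rw [List.length_append, length_wpow]; omega
  have ht' : t <+: v₂ ++ wpow v (M + E) := by
    refine List.prefix_of_prefix_length_le ht (List.prefix_append _ _) ?_
    rw [List.length_append, length_wpow, Nat.add_mul]; omega
  refine ⟨a, M + 1 + (M + E), fun ha => hc (ha.of_mem_img (n := q) (by simp [hst])), ?_⟩
  obtain ⟨s', hs'⟩ := hs'
  obtain ⟨t', ht'⟩ := ht'
  rw [hsplit, hst, ← hs', ← ht']
  exact ⟨s', t', by simp⟩

/-- Primitive words containing an unbounded letter all of whose powers are factors of the iterates
of `w` have at most as many lengths as there are letters. -/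
lemma finite_length_of_not_bounded [Finite A] (f : A → List A) (w : List A) :
    {l | ∃ v : List A, v.length = l ∧ Primitive v ∧ (∃ c ∈ v, ¬ Bounded f c) ∧
      ∀ N, ∃ n, wpow v N <:+: img f n w}.Finite := by
  by_contra hinf
  have := Fintype.ofFinite A
  obtain ⟨T, hT, hcard⟩ := Set.Infinite.exists_subset_card_eq hinf (Fintype.card A + 1)
  have hex : ∀ l : T, ∃ v : List A, v.length = l ∧ Primitive v ∧ (∃ c ∈ v, ¬ Bounded f c) ∧
      ∀ N, ∃ n, wpow v N <:+: img f n w := fun l => hT l.2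
  choose v hvl hvp hvc hvw using hex
  -- Twice the largest length in `T` covers the sum of two lengths required by Fine–Wilf.
  obtain ⟨q, hq⟩ : ∃ q, ∀ a, ¬ Bounded f a → 2 * T.sup id ≤ (img f q [a]).length := by
    refine Filter.Eventually.exists (f := Filter.atTop) (Filter.eventually_all.2 fun a => ?_)
    by_cases ha : Bounded f a
    · simp [ha]
    · filter_upwards [eventually_le_length_img ha (2 * T.sup id)] with n hn _ using hn
  choose a k ha hak using fun l => exists_img_infix_wpow (hvc l) (hvw l) q
  obtain ⟨i, j, hij, hae⟩ := Fintype.exists_ne_map_eq_of_card_lt a (by simp [hcard])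
  have hi : (v i).length ≤ T.sup id := by rw [hvl]; exact Finset.le_sup (f := id) i.2
  have hj : (v j).length ≤ T.sup id := by rw [hvl]; exact Finset.le_sup (f := id) j.2
  have h1 := hak i
  have h2 := hak j
  rw [← hae] at h2
  have hlen := hq _ (ha i)
  have d1 := (hvp i).length_dvd h1 h2 (by omega)
  have d2 := (hvp j).length_dvd h2 h1 (by omega)
  have := Nat.dvd_antisymm d1 d2
  rw [hvl, hvl] at this
  exact hij (Subtype.ext this)

/-! ### Finiteness, and passage from lists to the free monoid -/

theorem finite_primitive_powers [Finite A] (f : A → List A) (w : List A) :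
    {v : List A | Primitive v ∧ ∀ N, ∃ n, wpow v N <:+: img f n w}.Finite := by
  obtain ⟨D, hD⟩ := exists_length_le_of_bounded f w
  obtain ⟨E, hE⟩ := (finite_length_of_not_bounded f w).bddAbove
  refine (List.finite_length_le A (max D E)).subset ?_
  rintro v ⟨hv, hpow⟩
  by_cases hb : ∀ x ∈ v, Bounded f x
  · exact (hD v hv hb hpow).trans (le_max_left _ _)
  · push Not at hb
    exact (hE ⟨v, rfl, hv, hb, hpow⟩).trans (le_max_right _ _)

lemma toList_pow (v : FreeMonoid A) (k : ℕ) :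
    FreeMonoid.toList (v ^ k) = wpow (FreeMonoid.toList v) k := by
  induction k with
  | zero => rfl
  | succ k ih => rw [pow_succ', FreeMonoid.toList_mul, ih, wpow_succ]

lemma toList_map_eq_flatMap (φ : FreeMonoid A →* FreeMonoid A) (u : FreeMonoid A) :
    FreeMonoid.toList (φ u) =
      (FreeMonoid.toList u).flatMap fun a => FreeMonoid.toList (φ (FreeMonoid.of a)) := by
  induction u using FreeMonoid.inductionOn' with
  | one => simp
  | of_mul a u ih => rw [map_mul, FreeMonoid.toList_mul, ih, FreeMonoid.toList_of_mul]; rfl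

lemma toList_iterate (φ : FreeMonoid A →* FreeMonoid A) (n : ℕ) (u : FreeMonoid A) :
    FreeMonoid.toList (φ^[n] u) =
      img (fun a => FreeMonoid.toList (φ (FreeMonoid.of a))) n (FreeMonoid.toList u) := by
  induction n with
  | zero => rfl
  | succ n ih => rw [Function.iterate_succ_apply', toList_map_eq_flatMap, ih, img_succ']; rfl

end D0LWords

theorem mainTheorem3 {A : Type*} [Finite A] (G : D0LSystem A) (hG : G.IsRepetitive) :
    {v : FreeMonoid A | IsPrimitiveWord v ∧ G.IsInfinitePeriodicFactor v}.Finite := by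
  refine ((D0LWords.finite_primitive_powers
    (fun a => FreeMonoid.toList (G.morphism (FreeMonoid.of a)))
    (FreeMonoid.toList G.start)).preimage FreeMonoid.toList.injective.injOn).subset ?_
  rintro v ⟨hv, -, hpow⟩
  refine ⟨fun z k h => hv (FreeMonoid.ofList z) k ?_, fun N => ?_⟩
  · apply FreeMonoid.toList.injective
    rw [D0LWords.toList_pow, h, FreeMonoid.toList_ofList]
  · rcases Nat.eq_zero_or_pos N with rfl | hN
    · exact ⟨0, List.nil_infix⟩
    · obtain ⟨u, ⟨n, rfl⟩, x, y, hxy⟩ := hpow N hN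
      refine ⟨n, FreeMonoid.toList x, FreeMonoid.toList y, ?_⟩
      rw [← D0LWords.toList_iterate, hxy, ← D0LWords.toList_pow]
      rfl
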